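/- A globular set is a sequence of sets $(A_n)_{n\in\mathbb N}$ with maps $s,t:A_{n+1}\to A_n$ satisfying $ss=st$ and $ts=tt$; let $\mathbf{GSet}$ be the category of globular sets and let $\mathbf 1$ be its terminal object. Let $(-)^*=((-)^*,\eta,\mu)$ be the free strict $\omega$-category monad on $\mathbf{GSet}$, i.e. the monad induced by the adjunction between the forgetful functor from strict $\omega$-categories (with strict $\omega$-functors) to $\mathbf{GSet}$ and its left adjoint. A globular collection is a morphism $g:G\to\mathbf 1^*$ in $\mathbf{GSet}$. For collections $g:G\to\mathbf 1^*$ and $h:H\to\mathbf 1^*$, let $G\circ H$ be the pullback of $!^*:G^*\to\mathbf 1^*$ and $h$, regarded as a collection via $G\circ H\to G^*\xrightarrow{g^*}\mathbf 1^{**}\xrightarrow{\mu_{\mathbf 1}}\mathbf 1^*$. A globular operad is a monoid in the category of collections with respect to $\circ$, with unit collection $\eta_{\mathbf 1}:\mathbf 1\to\mathbf 1^*$: a collection $g:G\to\mathbf 1^*$ with morphisms of collections $ids:\mathbf 1\to G$ and $comp:G\circ G\to G$ satisfying the identity and associativity axioms. A morphism of globular operads is a morphism of collections preserving $ids$ and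 $comp$. A globular operad $G$ induces a monad $(-)_G$ on $\mathbf{GSet}$, where $A_G$ is the pullback of $!^*:A^*\to\mathbf 1^*$ and $g:G\to\mathbf 1^*$, with unit induced by $\eta_A$ and $ids$, and multiplication induced by $\mu_A$ and $comp$. Let $G\text{-}\mathbf{Alg}$ be the category of algebras for this monad. A morphism of globular operads $f:G\to H$ induces, for each globular set $A$, the morphism $A_f:A_G\to A_H$ which is the identity on the component in $A^*$ and $f$ on the component in $G$, and hence a functor $f^\ast:H\text{-}\mathbf{Alg}\to G\text{-}\mathbf{Alg}$ sending $(A,\theta)$ to $(A,\theta\cdot A_f)$ and acting as the identity on underlying morphisms of globular sets. **Proposition.** Let $f:G\to H$ be a morphism of globular operads whose underlying morphism of globular sets is a split epimorphism, i.e. there is a morphism of globular sets $f':H\to G$ (not required to be a morphism of operads) with $ff'=1_H$. Then the induced functor $f^\ast:H\text{-}\mathbf{Alg}\to G\text{-}\mathbf{Alg}$ is injective on objects and full. -/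

import Mathlib

open CategoryTheory CategoryTheory.Limits

universe u v

/-! ### Globular sets -/

/-- A globular set: sets of `n`-cells with source and target maps satisfying
`ss = st` and `ts = tt`. -/
structure GlobularSet : Type (u + 1) where
  cells : ℕ → Type u
  s : ∀ {n : ℕ}, cells (n + 1) → cells n
  t : ∀ {n : ℕ}, cells (n + 1) → cells n
  s_s : ∀ {n : ℕ} (x : cells (n + 2)), s (s x) = s (t x)
  t_s : ∀ {n : ℕ} (x : cells (n + 2)), t (s x) = t (t x)

namespace GlobularSet

/-- A morphism of globular sets: functions on `n`-cells preserving sources and targets. -/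
@[ext]
structure Hom (A B : GlobularSet.{u}) : Type u where
  map : ∀ {n : ℕ}, A.cells n → B.cells n
  map_s : ∀ {n : ℕ} (x : A.cells (n + 1)), map (A.s x) = B.s (map x)
  map_t : ∀ {n : ℕ} (x : A.cells (n + 1)), map (A.t x) = B.t (map x)

instance : Category GlobularSet.{u} where
  Hom := Hom
  id A := { map := fun x => x, map_s := fun _ => rfl, map_t := fun _ => rfl }
  comp f g :=
    { map := fun x => g.map (f.map x)
      map_s := fun x => by rw [f.map_s, g.map_s]
      map_t := fun x => by rw [f.map_t, g.map_t] }

theorem hom_ext {A B : GlobularSet.{u}} {f g : A ⟶ B}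
    (h : ∀ (n : ℕ) (x : A.cells n), f.map x = g.map x) : f = g := by
  apply Hom.ext
  funext n x
  exact h n x

@[simp]
theorem id_map {A : GlobularSet.{u}} {n : ℕ} (x : A.cells n) : Hom.map (𝟙 A) x = x := rfl

@[simp]
theorem comp_map {A B C : GlobularSet.{u}} (f : A ⟶ B) (g : B ⟶ C) {n : ℕ} (x : A.cells n) :
    Hom.map (f ≫ g) x = g.map (f.map x) := rfl

/-- The terminal globular set, with a single cell in each dimension. -/
def point : GlobularSet.{u} where
  cells _ := PUnit
  s _ := PUnit.unit
  t _ := PUnit.unit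
  s_s _ := rfl
  t_s _ := rfl

/-- `point` is terminal. -/
def pointIsTerminal : IsTerminal point.{u} :=
  IsTerminal.ofUniqueHom
    (fun _ => { map := fun _ => PUnit.unit, map_s := fun _ => rfl, map_t := fun _ => rfl })
    (fun _ _ => hom_ext fun _ _ => rfl)

instance : HasTerminal GlobularSet.{u} := pointIsTerminal.hasTerminal

/-- The pullback of globular sets, computed dimensionwise. -/
def fiberProd {A B C : GlobularSet.{u}} (f : A ⟶ C) (g : B ⟶ C) : GlobularSet.{u} where
  cells n := { x : A.cells n × B.cells n // f.map x.1 = g.map x.2 }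
  s x := ⟨(A.s x.1.1, B.s x.1.2), by
    have h := x.2
    simp only [f.map_s, g.map_s, h]⟩
  t x := ⟨(A.t x.1.1, B.t x.1.2), by
    have h := x.2
    simp only [f.map_t, g.map_t, h]⟩
  s_s x := by simp only [A.s_s, B.s_s]
  t_s x := by simp only [A.t_s, B.t_s]

def fiberProdFst {A B C : GlobularSet.{u}} (f : A ⟶ C) (g : B ⟶ C) : fiberProd f g ⟶ A where
  map x := x.1.1
  map_s _ := rfl
  map_t _ := rfl

def fiberProdSnd {A B C : GlobularSet.{u}} (f : A ⟶ C) (g : B ⟶ C) : fiberProd f g ⟶ B where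
  map x := x.1.2
  map_s _ := rfl
  map_t _ := rfl

theorem fiberProd_condition {A B C : GlobularSet.{u}} (f : A ⟶ C) (g : B ⟶ C) :
    fiberProdFst f g ≫ f = fiberProdSnd f g ≫ g :=
  hom_ext fun _ x => x.2

def fiberProdLift {A B C D : GlobularSet.{u}} (f : A ⟶ C) (g : B ⟶ C) (a : D ⟶ A) (b : D ⟶ B)
    (h : a ≫ f = b ≫ g) : D ⟶ fiberProd f g where
  map x := ⟨(a.map x, b.map x), congrArg (fun k : D ⟶ C => k.map x) h⟩
  map_s x := Subtype.ext (Prod.ext (a.map_s x) (b.map_s x))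
  map_t x := Subtype.ext (Prod.ext (a.map_t x) (b.map_t x))

/-- `fiberProd f g` is a pullback of `f` and `g`. -/
def fiberProdIsLimit {A B C : GlobularSet.{u}} (f : A ⟶ C) (g : B ⟶ C) :
    IsLimit (PullbackCone.mk (fiberProdFst f g) (fiberProdSnd f g) (fiberProd_condition f g)) :=
  PullbackCone.IsLimit.mk _
    (fun c => fiberProdLift f g c.fst c.snd c.condition)
    (fun _ => rfl) (fun _ => rfl)
    (fun c m h₁ h₂ => hom_ext fun n x => Subtype.ext (Prod.ext
      (congrArg (fun k : c.pt ⟶ A => k.map x) h₁) (congrArg (fun k : c.pt ⟶ B => k.map x) h₂)))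

instance : HasPullbacks GlobularSet.{u} :=
  @hasPullbacks_of_hasLimit_cospan _ _ fun {_ _ _ f g} => ⟨⟨⟨_, fiberProdIsLimit f g⟩⟩⟩

/-- The `k`-dimensional source of an `n`-cell, `k ≤ n`. -/
def src (A : GlobularSet.{u}) (k : ℕ) : ∀ {n : ℕ}, k ≤ n → A.cells n → A.cells k
  | 0, h, x => (Nat.le_zero.1 h).symm ▸ x
  | n + 1, h, x =>
      if e : k = n + 1 then e.symm ▸ x else A.src k (n := n) (by omega) (A.s x)

/-- The `k`-dimensional target of an `n`-cell, `k ≤ n`. -/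
def tgt (A : GlobularSet.{u}) (k : ℕ) : ∀ {n : ℕ}, k ≤ n → A.cells n → A.cells k
  | 0, h, x => (Nat.le_zero.1 h).symm ▸ x
  | n + 1, h, x =>
      if e : k = n + 1 then e.symm ▸ x else A.tgt k (n := n) (by omega) (A.t x)

/-- The iterate `cells k → cells n`, `k ≤ n`, of a family of maps `cells m → cells (m + 1)`. -/
def iter (A : GlobularSet.{u}) (i : ∀ {m : ℕ}, A.cells m → A.cells (m + 1)) (k : ℕ) :
    ∀ {n : ℕ}, k ≤ n → A.cells k → A.cells n
  | 0, h, x => Nat.le_zero.1 h ▸ x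
  | n + 1, h, x =>
      if e : k = n + 1 then e ▸ x else i (A.iter i k (n := n) (by omega) x)

theorem src_self (A : GlobularSet.{u}) {n : ℕ} (x : A.cells n) : A.src n le_rfl x = x := by
  cases n <;> simp [src]

theorem src_succ (A : GlobularSet.{u}) {k n : ℕ} (h : k ≤ n) (x : A.cells (n + 1)) :
    A.src k (Nat.le_succ_of_le h) x = A.src k h (A.s x) := by
  have e : k ≠ n + 1 := by omega
  simp [src, e]

theorem tgt_self (A : GlobularSet.{u}) {n : ℕ} (x : A.cells n) : A.tgt n le_rfl x = x := by
  cases n <;> simp [tgt]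

theorem tgt_succ (A : GlobularSet.{u}) {k n : ℕ} (h : k ≤ n) (x : A.cells (n + 1)) :
    A.tgt k (Nat.le_succ_of_le h) x = A.tgt k h (A.t x) := by
  have e : k ≠ n + 1 := by omega
  simp [tgt, e]

theorem iter_self (A : GlobularSet.{u}) (i : ∀ {m : ℕ}, A.cells m → A.cells (m + 1)) {n : ℕ}
    (x : A.cells n) : A.iter i n le_rfl x = x := by
  cases n <;> simp [iter]

theorem iter_succ (A : GlobularSet.{u}) (i : ∀ {m : ℕ}, A.cells m → A.cells (m + 1)) {k n : ℕ}
    (h : k ≤ n) (x : A.cells k) :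
    A.iter i k (Nat.le_succ_of_le h) x = i (A.iter i k h x) := by
  have e : k ≠ n + 1 := by omega
  simp [iter, e]

theorem map_src {A B : GlobularSet.{u}} (f : A ⟶ B) {k n : ℕ} (h : k ≤ n) (x : A.cells n) :
    f.map (A.src k h x) = B.src k h (f.map x) := by
  induction n, h using Nat.le_induction with
  | base => rw [src_self, src_self]
  | succ n h ih => rw [src_succ _ h, src_succ _ h, ih, f.map_s]

theorem map_tgt {A B : GlobularSet.{u}} (f : A ⟶ B) {k n : ℕ} (h : k ≤ n) (x : A.cells n) :
    f.map (A.tgt k h x) = B.tgt k h (f.map x) := by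
  induction n, h using Nat.le_induction with
  | base => rw [tgt_self, tgt_self]
  | succ n h ih => rw [tgt_succ _ h, tgt_succ _ h, ih, f.map_t]

theorem map_iter {A B : GlobularSet.{u}} (f : A ⟶ B)
    (i : ∀ {m : ℕ}, A.cells m → A.cells (m + 1)) (j : ∀ {m : ℕ}, B.cells m → B.cells (m + 1))
    (hij : ∀ {m : ℕ} (x : A.cells m), f.map (i x) = j (f.map x))
    {k n : ℕ} (h : k ≤ n) (x : A.cells k) :
    f.map (A.iter i k h x) = B.iter j k h (f.map x) := by
  induction n, h using Nat.le_induction with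
  | base => rw [iter_self, iter_self]
  | succ n h ih => rw [iter_succ _ _ h, iter_succ _ _ h, hij, ih]

end GlobularSet

/-! ### Strict `ω`-categories -/

/-- A strict `ω`-category: a globular set with identities `one x : x ⟶ x` and, for `p < n`, a
composition of `n`-cells `x`, `y` along a common `p`-cell `tgt p x = src p y` (in diagrammatic
order). Each equation between composites is required whenever the composites in it are defined. -/
structure StrictOmegaCat : Type (u + 1) extends GlobularSet.{u} where
  one : ∀ {n : ℕ}, cells n → cells (n + 1)
  comp : ∀ (p : ℕ) {n : ℕ} (h : p < n) (x y : cells n),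
    toGlobularSet.tgt p h.le x = toGlobularSet.src p h.le y → cells n
  s_one : ∀ {n : ℕ} (x : cells n), s (one x) = x
  t_one : ∀ {n : ℕ} (x : cells n), t (one x) = x
  s_comp_self : ∀ {n : ℕ} (x y : cells (n + 1)) (e), s (comp n (Nat.lt_succ_self n) x y e) = s x
  t_comp_self : ∀ {n : ℕ} (x y : cells (n + 1)) (e), t (comp n (Nat.lt_succ_self n) x y e) = t y
  s_comp : ∀ {p n : ℕ} (h : p < n) (x y : cells (n + 1)) (e e'),
    s (comp p (Nat.lt_succ_of_lt h) x y e) = comp p h (s x) (s y) e'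
  t_comp : ∀ {p n : ℕ} (h : p < n) (x y : cells (n + 1)) (e e'),
    t (comp p (Nat.lt_succ_of_lt h) x y e) = comp p h (t x) (t y) e'
  comp_assoc : ∀ {p n : ℕ} (h : p < n) (x y z : cells n) (e₁ e₂ e₃ e₄),
    comp p h (comp p h x y e₁) z e₂ = comp p h x (comp p h y z e₃) e₄
  one_comp : ∀ {p n : ℕ} (h : p < n) (x : cells n) (e),
    comp p h (toGlobularSet.iter one p h.le (toGlobularSet.src p h.le x)) x e = x
  comp_one : ∀ {p n : ℕ} (h : p < n) (x : cells n) (e),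
    comp p h x (toGlobularSet.iter one p h.le (toGlobularSet.tgt p h.le x)) e = x
  one_interchange : ∀ {p n : ℕ} (h : p < n) (x y : cells n) (e e'),
    one (comp p h x y e) = comp p (Nat.lt_succ_of_lt h) (one x) (one y) e'
  interchange : ∀ {q p n : ℕ} (hq : q < p) (hp : p < n) (x x' y y' : cells n)
    (e₁ e₂ e₃ e₄ e₅ e₆),
    comp q (hq.trans hp) (comp p hp x x' e₁) (comp p hp y y' e₂) e₃ =
      comp p hp (comp q (hq.trans hp) x y e₄) (comp q (hq.trans hp) x' y' e₅) e₆

namespace StrictOmegaCat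

/-- A strict `ω`-functor: a morphism of globular sets preserving identities and composition. -/
@[ext]
structure Hom (X Y : StrictOmegaCat.{u}) : Type u where
  hom : X.toGlobularSet ⟶ Y.toGlobularSet
  map_one : ∀ {n : ℕ} (x : X.cells n), hom.map (X.one x) = Y.one (hom.map x)
  map_comp : ∀ {p n : ℕ} (h : p < n) (x y : X.cells n) (e e'),
    hom.map (X.comp p h x y e) = Y.comp p h (hom.map x) (hom.map y) e'

theorem map_composable {A B : GlobularSet.{u}} (f : A ⟶ B) {p n : ℕ} (h : p < n)
    {x y : A.cells n} (e : A.tgt p h.le x = A.src p h.le y) :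
    B.tgt p h.le (f.map x) = B.src p h.le (f.map y) := by
  rw [← GlobularSet.map_tgt, ← GlobularSet.map_src, e]

instance : Category StrictOmegaCat.{u} where
  Hom := Hom
  id X := { hom := 𝟙 _, map_one := fun _ => rfl, map_comp := fun _ _ _ _ _ => rfl }
  comp f g :=
    { hom := f.hom ≫ g.hom
      map_one := fun x => by
        simp only [GlobularSet.comp_map]
        rw [f.map_one, g.map_one]
      map_comp := fun h x y e e' => by
        simp only [GlobularSet.comp_map]
        rw [f.map_comp h x y e (map_composable f.hom h e), g.map_comp] }

/-- The forgetful functor from strict `ω`-categories to globular sets. -/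
def forget : StrictOmegaCat.{u} ⥤ GlobularSet.{u} where
  obj X := X.toGlobularSet
  map f := f.hom

end StrictOmegaCat

/-! ### The free strict `ω`-category on a globular set

We construct a left adjoint of the forgetful functor: an `n`-cell is a well-formed formal
composite of cells, two formal composites being identified if they have the same value in every
strict `ω`-category. -/

namespace FreeOmega

/-- Formal composites of cells of `A`. -/
inductive Tm (A : GlobularSet.{u}) : ℕ → Type u
  | gen {n : ℕ} (x : A.cells n) : Tm A n
  | one {n : ℕ} (x : Tm A n) : Tm A (n + 1)
  | comp (p : ℕ) {n : ℕ} (h : p < n) (x y : Tm A n) : Tm A n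

variable {A : GlobularSet.{u}}

open Classical in
/-- The value of a formal composite in a strict `ω`-category (a junk value is used for
composites that are not defined). -/
noncomputable def ev (X : StrictOmegaCat.{u}) (φ : A ⟶ X.toGlobularSet) :
    ∀ {n : ℕ}, Tm A n → X.cells n
  | _, .gen x => φ.map x
  | _, .one x => X.one (ev X φ x)
  | _, .comp p h x y =>
      if e : X.tgt p h.le (ev X φ x) = X.src p h.le (ev X φ y)
      then X.comp p h (ev X φ x) (ev X φ y) e else ev X φ x

/-- A formal composite is well-formed if each composite in it is defined in every strict
`ω`-category. -/
def WF : ∀ {n : ℕ}, Tm A n → Prop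
  | _, .gen _ => True
  | _, .one x => WF x
  | _, .comp p h x y => WF x ∧ WF y ∧
      ∀ (X : StrictOmegaCat.{u}) (φ : A ⟶ X.toGlobularSet),
        X.tgt p h.le (ev X φ x) = X.src p h.le (ev X φ y)

theorem wf_gen {n : ℕ} (x : A.cells n) : WF (.gen x : Tm A n) := trivial

theorem wf_one {n : ℕ} {x : Tm A n} (h : WF x) : WF (.one x) := h

theorem wf_comp {p n : ℕ} {h : p < n} {x y : Tm A n} (hx : WF x) (hy : WF y)
    (e : ∀ (X : StrictOmegaCat.{u}) (φ : A ⟶ X.toGlobularSet),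
      X.tgt p h.le (ev X φ x) = X.src p h.le (ev X φ y)) : WF (.comp p h x y) := ⟨hx, hy, e⟩

theorem ev_comp (X : StrictOmegaCat.{u}) (φ : A ⟶ X.toGlobularSet) (p : ℕ) {n : ℕ} (h : p < n)
    (x y : Tm A n) (e : X.tgt p h.le (ev X φ x) = X.src p h.le (ev X φ y)) :
    ev X φ (.comp p h x y) = X.comp p h (ev X φ x) (ev X φ y) e := by
  simp [ev, e]

theorem _root_.GlobularSet.composable_s (B : GlobularSet.{u}) {p n : ℕ} (h : p < n)
    {x y : B.cells (n + 1)}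
    (e : B.tgt p (Nat.lt_succ_of_lt h).le x = B.src p (Nat.lt_succ_of_lt h).le y) :
    B.tgt p h.le (B.s x) = B.src p h.le (B.s y) := by
  obtain ⟨m, rfl⟩ : ∃ m, n = m + 1 := ⟨n - 1, by omega⟩
  have hm : p ≤ m := by omega
  rw [B.tgt_succ (Nat.le_succ_of_le hm), B.tgt_succ hm, B.src_succ (Nat.le_succ_of_le hm)] at e
  rw [B.tgt_succ hm, B.t_s, e]

theorem _root_.GlobularSet.composable_t (B : GlobularSet.{u}) {p n : ℕ} (h : p < n)
    {x y : B.cells (n + 1)}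
    (e : B.tgt p (Nat.lt_succ_of_lt h).le x = B.src p (Nat.lt_succ_of_lt h).le y) :
    B.tgt p h.le (B.t x) = B.src p h.le (B.t y) := by
  obtain ⟨m, rfl⟩ : ∃ m, n = m + 1 := ⟨n - 1, by omega⟩
  have hm : p ≤ m := by omega
  rw [B.tgt_succ (Nat.le_succ_of_le hm), B.src_succ (Nat.le_succ_of_le hm), B.src_succ hm] at e
  rw [e, B.src_succ hm, B.s_s]

/-- The source of a formal composite. -/
def Tm.s : ∀ {n : ℕ}, Tm A (n + 1) → Tm A n
  | _, .gen x => .gen (A.s x)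
  | _, .one x => x
  | n, .comp p h x y => if e : p = n then x.s else .comp p (by omega) x.s y.s

/-- The target of a formal composite. -/
def Tm.t : ∀ {n : ℕ}, Tm A (n + 1) → Tm A n
  | _, .gen x => .gen (A.t x)
  | _, .one x => x
  | n, .comp p h x y => if e : p = n then y.t else .comp p (by omega) x.t y.t

theorem s_spec : ∀ {n : ℕ} (x : Tm A (n + 1)), WF x →
    WF x.s ∧ ∀ (X : StrictOmegaCat.{u}) (φ : A ⟶ X.toGlobularSet), ev X φ x.s = X.s (ev X φ x)
  | _, .gen x, _ => by
    simp only [Tm.s, ev]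
    exact ⟨wf_gen _, fun X φ => φ.map_s x⟩
  | _, .one x, h => by
    simp only [Tm.s, ev]
    exact ⟨h, fun X φ => (X.s_one _).symm⟩
  | n, .comp p hp x y, h => by
    obtain ⟨hx, hy, hc⟩ := h
    obtain ⟨hx₁, hx₂⟩ := s_spec x hx
    obtain ⟨hy₁, hy₂⟩ := s_spec y hy
    by_cases e : p = n
    · subst e
      refine ⟨by simpa [Tm.s] using hx₁, fun X φ => ?_⟩
      rw [ev_comp X φ _ _ _ _ (hc X φ), X.s_comp_self]
      simpa [Tm.s] using hx₂ X φ
    · have hpn : p < n := by omega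
      have hc' : ∀ (X : StrictOmegaCat.{u}) (φ : A ⟶ X.toGlobularSet),
          X.tgt p hpn.le (ev X φ x.s) = X.src p hpn.le (ev X φ y.s) := fun X φ => by
        rw [hx₂, hy₂]
        exact GlobularSet.composable_s _ hpn (hc X φ)
      have hs : (Tm.comp p hp x y).s = .comp p hpn x.s y.s := by simp [Tm.s, e]
      rw [hs]
      refine ⟨⟨hx₁, hy₁, hc'⟩, fun X φ => ?_⟩
      rw [ev_comp X φ _ _ _ _ (hc X φ), ev_comp X φ _ _ _ _ (hc' X φ)]
      rw [X.s_comp hpn _ _ _ (GlobularSet.composable_s _ hpn (hc X φ))]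
      congr 1
      · exact hx₂ X φ
      · exact hy₂ X φ

theorem t_spec : ∀ {n : ℕ} (x : Tm A (n + 1)), WF x →
    WF x.t ∧ ∀ (X : StrictOmegaCat.{u}) (φ : A ⟶ X.toGlobularSet), ev X φ x.t = X.t (ev X φ x)
  | _, .gen x, _ => by
    simp only [Tm.t, ev]
    exact ⟨wf_gen _, fun X φ => φ.map_t x⟩
  | _, .one x, h => by
    simp only [Tm.t, ev]
    exact ⟨h, fun X φ => (X.t_one _).symm⟩
  | n, .comp p hp x y, h => by
    obtain ⟨hx, hy, hc⟩ := h
    obtain ⟨hx₁, hx₂⟩ := t_spec x hx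
    obtain ⟨hy₁, hy₂⟩ := t_spec y hy
    by_cases e : p = n
    · subst e
      refine ⟨by simpa [Tm.t] using hy₁, fun X φ => ?_⟩
      rw [ev_comp X φ _ _ _ _ (hc X φ), X.t_comp_self]
      simpa [Tm.t] using hy₂ X φ
    · have hpn : p < n := by omega
      have hc' : ∀ (X : StrictOmegaCat.{u}) (φ : A ⟶ X.toGlobularSet),
          X.tgt p hpn.le (ev X φ x.t) = X.src p hpn.le (ev X φ y.t) := fun X φ => by
        rw [hx₂, hy₂]
        exact GlobularSet.composable_t _ hpn (hc X φ)
      have hs : (Tm.comp p hp x y).t = .comp p hpn x.t y.t := by simp [Tm.t, e]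
      rw [hs]
      refine ⟨⟨hx₁, hy₁, hc'⟩, fun X φ => ?_⟩
      rw [ev_comp X φ _ _ _ _ (hc X φ), ev_comp X φ _ _ _ _ (hc' X φ)]
      rw [X.t_comp hpn _ _ _ (GlobularSet.composable_t _ hpn (hc X φ))]
      congr 1
      · exact hx₂ X φ
      · exact hy₂ X φ

/-- Two formal composites are identified if they have the same value in every strict
`ω`-category. -/
def setoid (A : GlobularSet.{u}) (n : ℕ) : Setoid { x : Tm A n // WF x } where
  r x y := ∀ (X : StrictOmegaCat.{u}) (φ : A ⟶ X.toGlobularSet), ev X φ x.1 = ev X φ y.1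
  iseqv :=
    { refl := fun _ _ _ => rfl
      symm := fun h X φ => (h X φ).symm
      trans := fun h h' X φ => (h X φ).trans (h' X φ) }

/-- The `n`-cells of the free strict `ω`-category on `A`. -/
def Cell (A : GlobularSet.{u}) (n : ℕ) : Type u := Quotient (setoid A n)

/-- The class of a well-formed formal composite. -/
def mk {n : ℕ} (x : Tm A n) (hx : WF x) : Cell A n := Quotient.mk (setoid A n) ⟨x, hx⟩

/-- The value of a cell of the free strict `ω`-category in a strict `ω`-category. -/
noncomputable def val (X : StrictOmegaCat.{u}) (φ : A ⟶ X.toGlobularSet) {n : ℕ}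
    (a : Cell A n) : X.cells n :=
  Quotient.lift (s := setoid A n) (fun x => ev X φ x.1) (fun _ _ h => h X φ) a

@[simp]
theorem val_mk (X : StrictOmegaCat.{u}) (φ : A ⟶ X.toGlobularSet) {n : ℕ} (x : Tm A n)
    (hx : WF x) : val X φ (mk x hx) = ev X φ x := rfl

theorem exists_rep {n : ℕ} (a : Cell A n) : ∃ (x : Tm A n) (hx : WF x), mk x hx = a := by
  obtain ⟨⟨x, hx⟩, h⟩ := Quotient.exists_rep a
  exact ⟨x, hx, h⟩

theorem cell_ext {n : ℕ} {a b : Cell A n}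
    (h : ∀ (X : StrictOmegaCat.{u}) (φ : A ⟶ X.toGlobularSet), val X φ a = val X φ b) :
    a = b := by
  obtain ⟨x, hx, rfl⟩ := exists_rep a
  obtain ⟨y, hy, rfl⟩ := exists_rep b
  exact Quotient.sound (s := setoid A n) h

theorem exists_s {n : ℕ} (a : Cell A (n + 1)) : ∃ b : Cell A n,
    ∀ (X : StrictOmegaCat.{u}) (φ : A ⟶ X.toGlobularSet), val X φ b = X.s (val X φ a) := by
  obtain ⟨x, hx, rfl⟩ := exists_rep a
  exact ⟨mk x.s (s_spec x hx).1, (s_spec x hx).2⟩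

theorem exists_t {n : ℕ} (a : Cell A (n + 1)) : ∃ b : Cell A n,
    ∀ (X : StrictOmegaCat.{u}) (φ : A ⟶ X.toGlobularSet), val X φ b = X.t (val X φ a) := by
  obtain ⟨x, hx, rfl⟩ := exists_rep a
  exact ⟨mk x.t (t_spec x hx).1, (t_spec x hx).2⟩

/-- The underlying globular set of the free strict `ω`-category on `A`. -/
noncomputable def gset (A : GlobularSet.{u}) : GlobularSet.{u} where
  cells := Cell A
  s a := (exists_s a).choose
  t a := (exists_t a).choose
  s_s a := cell_ext fun X φ => by
    rw [(exists_s _).choose_spec, (exists_s _).choose_spec, (exists_s _).choose_spec,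
      (exists_t _).choose_spec, X.s_s]
  t_s a := cell_ext fun X φ => by
    rw [(exists_t _).choose_spec, (exists_t _).choose_spec, (exists_s _).choose_spec,
      (exists_t _).choose_spec, X.t_s]

/-- The values in a strict `ω`-category form a morphism of globular sets. -/
noncomputable def valHom (X : StrictOmegaCat.{u}) (φ : A ⟶ X.toGlobularSet) :
    gset A ⟶ X.toGlobularSet where
  map a := val X φ a
  map_s a := (exists_s a).choose_spec X φ
  map_t a := (exists_t a).choose_spec X φ

theorem gset_ext {n : ℕ} {a b : (gset A).cells n}
    (h : ∀ (X : StrictOmegaCat.{u}) (φ : A ⟶ X.toGlobularSet),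
      (valHom X φ).map a = (valHom X φ).map b) : a = b :=
  cell_ext h

/-- The class of a well-formed formal composite, as a cell of `gset A`. -/
def cls {n : ℕ} (x : Tm A n) (hx : WF x) : (gset A).cells n := mk x hx

theorem exists_cls {n : ℕ} (a : (gset A).cells n) : ∃ (x : Tm A n) (hx : WF x), cls x hx = a :=
  exists_rep a

theorem val_cls (X : StrictOmegaCat.{u}) (φ : A ⟶ X.toGlobularSet) {n : ℕ} (x : Tm A n)
    (hx : WF x) : (valHom X φ).map (cls x hx) = ev X φ x := rfl

/-- The identity on a cell. -/
noncomputable def cellOne {n : ℕ} (a : (gset A).cells n) : (gset A).cells (n + 1) :=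
  cls (.one (exists_cls a).choose) (wf_one (exists_cls a).choose_spec.choose)

theorem val_one (X : StrictOmegaCat.{u}) (φ : A ⟶ X.toGlobularSet) {n : ℕ}
    (a : (gset A).cells n) : (valHom X φ).map (cellOne a) = X.one ((valHom X φ).map a) := by
  rw [cellOne, val_cls, ev, ← val_cls X φ _ (exists_cls a).choose_spec.choose,
    (exists_cls a).choose_spec.choose_spec]

theorem ev_choose (X : StrictOmegaCat.{u}) (φ : A ⟶ X.toGlobularSet) {n : ℕ}
    (a : (gset A).cells n) : ev X φ (exists_cls a).choose = (valHom X φ).map a := by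
  rw [← val_cls X φ _ (exists_cls a).choose_spec.choose, (exists_cls a).choose_spec.choose_spec]

theorem val_iter (X : StrictOmegaCat.{u}) (φ : A ⟶ X.toGlobularSet) {p n : ℕ} (h : p ≤ n)
    (a : (gset A).cells p) :
    (valHom X φ).map ((gset A).iter (fun {_} x => cellOne x) p h a) =
      X.iter (fun {_} x => X.one x) p h ((valHom X φ).map a) :=
  GlobularSet.map_iter (valHom X φ) _ _ (fun x => val_one X φ x) h a

/-- The composite of two cells. -/
noncomputable def cellComp (p : ℕ) {n : ℕ} (h : p < n) (a b : (gset A).cells n)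
    (e : (gset A).tgt p h.le a = (gset A).src p h.le b) : (gset A).cells n :=
  cls (.comp p h (exists_cls a).choose (exists_cls b).choose)
    (wf_comp (exists_cls a).choose_spec.choose (exists_cls b).choose_spec.choose fun X φ => by
      rw [ev_choose, ev_choose]
      exact StrictOmegaCat.map_composable (valHom X φ) h e)

theorem val_comp (X : StrictOmegaCat.{u}) (φ : A ⟶ X.toGlobularSet) {p n : ℕ} (h : p < n)
    (a b : (gset A).cells n) (e : (gset A).tgt p h.le a = (gset A).src p h.le b) :
    (valHom X φ).map (cellComp p h a b e) =
      X.comp p h ((valHom X φ).map a) ((valHom X φ).map b)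
        (StrictOmegaCat.map_composable (valHom X φ) h e) := by
  have e' : X.tgt p h.le (ev X φ (exists_cls a).choose) =
      X.src p h.le (ev X φ (exists_cls b).choose) := by
    rw [ev_choose, ev_choose]
    exact StrictOmegaCat.map_composable (valHom X φ) h e
  rw [cellComp, val_cls, ev_comp X φ p h _ _ e']
  congr 1 <;> exact ev_choose X φ _

/-- The free strict `ω`-category on `A`. -/
noncomputable def free (A : GlobularSet.{u}) : StrictOmegaCat.{u} where
  toGlobularSet := gset A
  one := cellOne
  comp := cellComp
  s_one x := gset_ext fun X φ => by rw [(valHom X φ).map_s, val_one, X.s_one]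
  t_one x := gset_ext fun X φ => by rw [(valHom X φ).map_t, val_one, X.t_one]
  s_comp_self x y e := gset_ext fun X φ => by
    rw [(valHom X φ).map_s, val_comp, X.s_comp_self, (valHom X φ).map_s]
  t_comp_self x y e := gset_ext fun X φ => by
    rw [(valHom X φ).map_t, val_comp, X.t_comp_self, (valHom X φ).map_t]
  s_comp h x y e e' := gset_ext fun X φ => by
    have c := GlobularSet.composable_s _ h
      (StrictOmegaCat.map_composable (valHom X φ) (Nat.lt_succ_of_lt h) e)
    rw [(valHom X φ).map_s, val_comp, val_comp, X.s_comp h _ _ _ c]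
    congr 1 <;> exact ((valHom X φ).map_s _).symm
  t_comp h x y e e' := gset_ext fun X φ => by
    have c := GlobularSet.composable_t _ h
      (StrictOmegaCat.map_composable (valHom X φ) (Nat.lt_succ_of_lt h) e)
    rw [(valHom X φ).map_t, val_comp, val_comp, X.t_comp h _ _ _ c]
    congr 1 <;> exact ((valHom X φ).map_t _).symm
  comp_assoc h x y z e₁ e₂ e₃ e₄ := gset_ext fun X φ => by
    have c₂ := StrictOmegaCat.map_composable (valHom X φ) h e₂
    have c₄ := StrictOmegaCat.map_composable (valHom X φ) h e₄
    simp only [val_comp] at c₂ c₄ ⊢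
    exact X.comp_assoc h _ _ _ _ c₂ _ c₄
  one_comp h x e := gset_ext fun X φ => by
    have c := StrictOmegaCat.map_composable (valHom X φ) h e
    simp only [val_comp, val_iter, GlobularSet.map_src] at c ⊢
    exact X.one_comp h _ c
  comp_one h x e := gset_ext fun X φ => by
    have c := StrictOmegaCat.map_composable (valHom X φ) h e
    simp only [val_comp, val_iter, GlobularSet.map_tgt] at c ⊢
    exact X.comp_one h _ c
  one_interchange h x y e e' := gset_ext fun X φ => by
    have c := StrictOmegaCat.map_composable (valHom X φ) (Nat.lt_succ_of_lt h) e'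
    simp only [val_comp, val_one] at c ⊢
    exact X.one_interchange h _ _ _ c
  interchange hq hp x x' y y' e₁ e₂ e₃ e₄ e₅ e₆ := gset_ext fun X φ => by
    have c₃ := StrictOmegaCat.map_composable (valHom X φ) (hq.trans hp) e₃
    have c₆ := StrictOmegaCat.map_composable (valHom X φ) hp e₆
    simp only [val_comp] at c₃ c₆ ⊢
    exact X.interchange hq hp _ _ _ _ _ _ c₃ _ _ c₆

/-- The inclusion of generators. -/
noncomputable def incl (A : GlobularSet.{u}) : A ⟶ gset A where
  map x := cls (.gen x) (wf_gen x)
  map_s x := gset_ext fun X φ => by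
    rw [(valHom X φ).map_s, val_cls, val_cls]
    exact φ.map_s x
  map_t x := gset_ext fun X φ => by
    rw [(valHom X φ).map_t, val_cls, val_cls]
    exact φ.map_t x

/-- The extension of a morphism of globular sets to a strict `ω`-functor. -/
noncomputable def extend (X : StrictOmegaCat.{u}) (φ : A ⟶ X.toGlobularSet) : free A ⟶ X where
  hom := valHom X φ
  map_one x := val_one X φ x
  map_comp h x y e _ := val_comp X φ h x y e

theorem cls_one {n : ℕ} (x : Tm A n) (hx : WF x) : cls (.one x) hx = cellOne (cls x hx) :=
  gset_ext fun X φ => (val_one X φ (cls x hx)).symm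

theorem cls_comp (p : ℕ) {n : ℕ} (h : p < n) (x y : Tm A n) (hx : WF x) (hy : WF y)
    (hxy : WF (.comp p h x y)) :
    ∃ e, cls (.comp p h x y) hxy = cellComp p h (cls x hx) (cls y hy) e := by
  have e : (gset A).tgt p h.le (cls x hx) = (gset A).src p h.le (cls y hy) :=
    gset_ext fun X φ => by
      rw [GlobularSet.map_tgt, GlobularSet.map_src]
      exact hxy.2.2 X φ
  refine ⟨e, gset_ext fun X φ => ?_⟩
  exact (ev_comp X φ p h x y (hxy.2.2 X φ)).trans (val_comp X φ h (cls x hx) (cls y hy) e).symm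

/-- The underlying morphism of globular sets of a functor on a free strict `ω`-category. -/
def und {X : StrictOmegaCat.{u}} (f : free A ⟶ X) : gset A ⟶ X.toGlobularSet := f.hom

theorem und_one {X : StrictOmegaCat.{u}} (f : free A ⟶ X) {n : ℕ} (a : (gset A).cells n) :
    (und f).map (cellOne a) = X.one ((und f).map a) := f.map_one a

theorem und_comp {X : StrictOmegaCat.{u}} (f : free A ⟶ X) {p n : ℕ} (h : p < n)
    (a b : (gset A).cells n) (e) :
    (und f).map (cellComp p h a b e) = X.comp p h ((und f).map a) ((und f).map b)
      (StrictOmegaCat.map_composable (und f) h e) := f.map_comp h a b e _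

theorem und_eq {X : StrictOmegaCat.{u}} (f g : free A ⟶ X)
    (h : incl A ≫ und f = incl A ≫ und g) :
    ∀ {n : ℕ} (x : Tm A n) (hx : WF x), (und f).map (cls x hx) = (und g).map (cls x hx)
  | _, .gen x, _ => congrArg (fun k : A ⟶ X.toGlobularSet => k.map x) h
  | _, .one x, hx => by
    rw [cls_one x hx, und_one, und_one, und_eq f g h x hx]
  | _, .comp p hp x y, hxy => by
    obtain ⟨e, he⟩ := cls_comp p hp x y hxy.1 hxy.2.1 hxy
    rw [he, und_comp, und_comp]
    congr 1
    · exact und_eq f g h x hxy.1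
    · exact und_eq f g h y hxy.2.1

/-- The universal property of the free strict `ω`-category. -/
noncomputable def homEquiv (A : GlobularSet.{u}) (X : StrictOmegaCat.{u}) :
    (free A ⟶ X) ≃ (A ⟶ StrictOmegaCat.forget.obj X) where
  toFun f := incl A ≫ und f
  invFun φ := extend X φ
  left_inv f := by
    apply StrictOmegaCat.Hom.ext
    refine GlobularSet.hom_ext fun n a => ?_
    obtain ⟨x, hx, rfl⟩ := exists_cls a
    exact und_eq (extend X (incl A ≫ und f)) f rfl x hx
  right_inv φ := rfl

/-- The free strict `ω`-category functor. -/
noncomputable def freeFunctor : GlobularSet.{u} ⥤ StrictOmegaCat.{u} :=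
  Adjunction.leftAdjointOfEquiv homEquiv fun _ _ _ _ _ => rfl

/-- The free strict `ω`-category functor is left adjoint to the forgetful functor. -/
noncomputable def adjunction : freeFunctor.{u} ⊣ StrictOmegaCat.forget.{u} :=
  Adjunction.adjunctionOfEquivLeft homEquiv fun _ _ _ _ _ => rfl

/-- The free strict `ω`-category monad `(-)^*` on globular sets. -/
noncomputable def monad : Monad GlobularSet.{u} := adjunction.toMonad

end FreeOmega

/-! ### Collections and operads over a monad

Here `T` is a monad on a category `C` with pullbacks and a terminal object `1`. The unit and
associativity comparisons of the composition `∘` of collections are given in the direction in which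
they exist for every such `T`; they are isomorphisms when `T` is cartesian, as is the free strict
`ω`-category monad. -/

namespace TOperad

theorem map_terminal {C : Type u} [Category.{v} C] [HasTerminal C] {T : Monad C} {A B : C}
    (f : A ⟶ B) : T.map f ≫ T.map (terminal.from B) = T.map (terminal.from A) := by
  rw [← T.map_comp, terminal.comp_from]

section

variable {C : Type u} [Category.{v} C] [HasPullbacks C] [HasTerminal C]

/-- The category of collections: the slice category over `T 1`. -/
abbrev Coll (T : Monad C) : Type (max u v) := Over (T.obj (⊤_ C))

variable {T : Monad C}

/-- For a collection `g : G ⟶ T 1` and an object `A`, the object `A_G`: the pullback of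
`T ! : T A ⟶ T 1` and `g`. -/
noncomputable def act (A : C) (G : Coll T) : C :=
  pullback (T.map (terminal.from A)) G.hom

noncomputable def actFst (A : C) (G : Coll T) : act A G ⟶ T.obj A :=
  pullback.fst _ _

noncomputable def actSnd (A : C) (G : Coll T) : act A G ⟶ G.left :=
  pullback.snd _ _

theorem act_condition (A : C) (G : Coll T) :
    actFst A G ≫ T.map (terminal.from A) = actSnd A G ≫ G.hom :=
  pullback.condition

noncomputable def actLift {A B : C} {G : Coll T} (a : B ⟶ T.obj A) (b : B ⟶ G.left)
    (h : a ≫ T.map (terminal.from A) = b ≫ G.hom) : B ⟶ act A G :=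
  pullback.lift a b h

@[simp]
theorem actLift_fst {A B : C} {G : Coll T} (a : B ⟶ T.obj A) (b : B ⟶ G.left)
    (h : a ≫ T.map (terminal.from A) = b ≫ G.hom) : actLift a b h ≫ actFst A G = a :=
  pullback.lift_fst _ _ _

@[simp]
theorem actLift_snd {A B : C} {G : Coll T} (a : B ⟶ T.obj A) (b : B ⟶ G.left)
    (h : a ≫ T.map (terminal.from A) = b ≫ G.hom) : actLift a b h ≫ actSnd A G = b :=
  pullback.lift_snd _ _ _

@[simp]
theorem actLift_fst_assoc {A B D : C} {G : Coll T} (a : B ⟶ T.obj A) (b : B ⟶ G.left)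
    (h : a ≫ T.map (terminal.from A) = b ≫ G.hom) (k : T.obj A ⟶ D) :
    actLift a b h ≫ actFst A G ≫ k = a ≫ k := by
  rw [← Category.assoc, actLift_fst]

@[simp]
theorem actLift_snd_assoc {A B D : C} {G : Coll T} (a : B ⟶ T.obj A) (b : B ⟶ G.left)
    (h : a ≫ T.map (terminal.from A) = b ≫ G.hom) (k : G.left ⟶ D) :
    actLift a b h ≫ actSnd A G ≫ k = b ≫ k := by
  rw [← Category.assoc, actLift_snd]

theorem act_hom_ext {A B : C} {G : Coll T} {a b : B ⟶ act A G}
    (h₁ : a ≫ actFst A G = b ≫ actFst A G) (h₂ : a ≫ actSnd A G = b ≫ actSnd A G) : a = b :=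
  pullback.hom_ext h₁ h₂

/-- The morphism `A_G ⟶ B_H` induced by `a : A ⟶ B` and a morphism of collections `G ⟶ H`. -/
noncomputable def actMap {A B : C} {G H : Coll T} (a : A ⟶ B) (b : G ⟶ H) :
    act A G ⟶ act B H :=
  actLift (actFst A G ≫ T.map a) (actSnd A G ≫ b.left) (by
    rw [Category.assoc, Category.assoc, map_terminal, Over.w, act_condition])

theorem actMap_fst {A B : C} {G H : Coll T} (a : A ⟶ B) (b : G ⟶ H) :
    actMap a b ≫ actFst B H = actFst A G ≫ T.map a :=
  actLift_fst _ _ _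

theorem actMap_snd {A B : C} {G H : Coll T} (a : A ⟶ B) (b : G ⟶ H) :
    actMap a b ≫ actSnd B H = actSnd A G ≫ b.left :=
  actLift_snd _ _ _

theorem actMap_id (A : C) (G : Coll T) : actMap (𝟙 A) (𝟙 G) = 𝟙 (act A G) := by
  apply act_hom_ext
  · rw [actMap_fst, T.map_id, Category.comp_id, Category.id_comp]
  · rw [actMap_snd, Over.id_left, Category.comp_id, Category.id_comp]

theorem actMap_comp {A B D : C} {G H K : Coll T} (a : A ⟶ B) (b : G ⟶ H) (a' : B ⟶ D)
    (b' : H ⟶ K) : actMap a b ≫ actMap a' b' = actMap (a ≫ a') (b ≫ b') := by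
  apply act_hom_ext
  · rw [Category.assoc, actMap_fst, ← Category.assoc, actMap_fst, actMap_fst, T.map_comp,
      Category.assoc]
  · rw [Category.assoc, actMap_snd, ← Category.assoc, actMap_snd, actMap_snd, Over.comp_left,
      Category.assoc]

/-- The composite `G ∘ H` of collections: the pullback of `T ! : T G ⟶ T 1` and `h : H ⟶ T 1`,
with structure map `G ∘ H ⟶ T G ⟶ T T 1 ⟶ T 1`. -/
noncomputable def tensorObj (G H : Coll T) : Coll T :=
  Over.mk (actFst G.left H ≫ T.map G.hom ≫ T.μ.app (⊤_ C))

/-- The composite of two morphisms of collections. -/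
noncomputable def tensorHom {G G' H H' : Coll T} (a : G ⟶ G') (b : H ⟶ H') :
    tensorObj G H ⟶ tensorObj G' H' :=
  Over.homMk (U := tensorObj G H) (V := tensorObj G' H') (actMap a.left b) (by
    have h : actMap a.left b ≫ actFst G'.left H' ≫ T.map G'.hom ≫ T.μ.app (⊤_ C) =
        actFst G.left H ≫ T.map G.hom ≫ T.μ.app (⊤_ C) := by
      rw [actMap, actLift_fst_assoc, Category.assoc, ← T.map_comp_assoc, Over.w]
    exact h)

/-- The unit collection `η : 1 ⟶ T 1`. -/
noncomputable def unitColl (T : Monad C) : Coll T := Over.mk (T.η.app (⊤_ C))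

/-- The left unit comparison `1 ∘ G ⟶ G`. -/
noncomputable def leftUnitor (G : Coll T) : tensorObj (unitColl T) G ⟶ G :=
  Over.homMk (U := tensorObj (unitColl T) G) (actSnd (⊤_ C) G) (by
    have h : actSnd (⊤_ C) G ≫ G.hom =
        actFst (⊤_ C) G ≫ T.map (T.η.app (⊤_ C)) ≫ T.μ.app (⊤_ C) := by
      have e : terminal.from (⊤_ C) = 𝟙 _ := Subsingleton.elim _ _
      rw [← act_condition, T.right_unit, e, T.map_id]
      rfl
    exact h)

/-- The morphism `A ⟶ A_1` to the pullback of `T !` and the unit collection. -/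
noncomputable def actUnit (A : C) : A ⟶ act A (unitColl T) :=
  actLift (G := unitColl T) (T.η.app A) (terminal.from A) (T.η.naturality (terminal.from A)).symm

theorem actUnit_fst (A : C) : actUnit A ≫ actFst A (unitColl T) = T.η.app A :=
  actLift_fst (G := unitColl T) _ _ _

theorem actUnit_snd (A : C) : actUnit A ≫ actSnd A (unitColl T) = terminal.from A :=
  actLift_snd (G := unitColl T) _ _ _

/-- The (inverse) right unit comparison `G ⟶ G ∘ 1`. -/
noncomputable def rightUnitorInv (G : Coll T) : G ⟶ tensorObj G (unitColl T) :=
  Over.homMk (V := tensorObj G (unitColl T)) (actUnit G.left) (by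
    have h : actUnit G.left ≫ actFst G.left (unitColl T) ≫ T.map G.hom ≫ T.μ.app (⊤_ C) =
        G.hom := by
      rw [← Category.assoc, actUnit_fst, ← T.unit_naturality_assoc, T.left_unit]
      exact Category.comp_id _
    exact h)

/-- For a collection `H`, the canonical morphism `(A_G)_H ⟶ G ∘ H` over the identity of `H`. -/
noncomputable def actProj (A : C) (G H : Coll T) : act (act A G) H ⟶ act G.left H :=
  actMap (actSnd A G) (𝟙 H)

/-- The canonical morphism `(A_G)_H ⟶ A_(G ∘ H)`, sending a pasting of pairs and an operation
to the flattened pasting and the pair formed by the operations. -/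
noncomputable def actAssoc (A : C) (G H : Coll T) :
    act (act A G) H ⟶ act A (tensorObj G H) :=
  actLift (G := tensorObj G H) (actFst (act A G) H ≫ T.map (actFst A G) ≫ T.μ.app A)
    (actProj A G H) (by
      have h : (actFst (act A G) H ≫ T.map (actFst A G) ≫ T.μ.app A) ≫ T.map (terminal.from A) =
          actProj A G H ≫ actFst G.left H ≫ T.map G.hom ≫ T.μ.app (⊤_ C) := by
        rw [actProj, actMap, actLift_fst_assoc]
        simp only [Category.assoc]
        rw [← T.mu_naturality, ← T.map_comp_assoc, ← T.map_comp_assoc, act_condition]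
      exact h)

theorem actAssoc_fst (A : C) (G H : Coll T) : actAssoc A G H ≫ actFst A (tensorObj G H) =
    actFst (act A G) H ≫ T.map (actFst A G) ≫ T.μ.app A :=
  actLift_fst (G := tensorObj G H) _ _ _

theorem actAssoc_snd (A : C) (G H : Coll T) :
    actAssoc A G H ≫ actSnd A (tensorObj G H) = actProj A G H :=
  actLift_snd (G := tensorObj G H) _ _ _

/-- The associativity comparison `(F ∘ G) ∘ H ⟶ F ∘ (G ∘ H)`. -/
noncomputable def associator (F G H : Coll T) :
    tensorObj (tensorObj F G) H ⟶ tensorObj F (tensorObj G H) :=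
  Over.homMk (U := tensorObj (tensorObj F G) H) (V := tensorObj F (tensorObj G H))
    (actAssoc F.left G H) (by
      have h : actAssoc F.left G H ≫ actFst F.left (tensorObj G H) ≫ T.map F.hom ≫
          T.μ.app (⊤_ C) = actFst (act F.left G) H ≫
            T.map (actFst F.left G ≫ T.map F.hom ≫ T.μ.app (⊤_ C)) ≫ T.μ.app (⊤_ C) := by
        rw [← Category.assoc, actAssoc_fst]
        simp only [Category.assoc, Functor.map_comp]
        rw [← T.mu_naturality_assoc, T.assoc]
      exact h)

end

end TOperad

/-- An operad over `T`: a monoid in the category of collections with respect to `∘`, that is, a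
collection with identities `1 ⟶ G` and composition `G ∘ G ⟶ G`, both morphisms of collections,
satisfying the two identity axioms and the associativity axiom. -/
structure TOperad {C : Type u} [Category.{v} C] [HasPullbacks C] [HasTerminal C] (T : Monad C) where
  coll : TOperad.Coll T
  ids : TOperad.unitColl T ⟶ coll
  comp : TOperad.tensorObj coll coll ⟶ coll
  ids_comp : TOperad.tensorHom ids (𝟙 coll) ≫ comp = TOperad.leftUnitor coll
  comp_ids : TOperad.rightUnitorInv coll ≫ TOperad.tensorHom (𝟙 coll) ids ≫ comp = 𝟙 coll
  assoc : TOperad.tensorHom comp (𝟙 coll) ≫ comp =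
    TOperad.associator coll coll coll ≫ TOperad.tensorHom (𝟙 coll) comp ≫ comp

namespace TOperad

section

variable {C : Type u} [Category.{v} C] [HasPullbacks C] [HasTerminal C] {T : Monad C}

/-- A morphism of operads: a morphism of collections preserving identities and composition. -/
structure Hom (G H : TOperad T) where
  hom : G.coll ⟶ H.coll
  ids_hom : G.ids ≫ hom = H.ids
  comp_hom : G.comp ≫ hom = tensorHom hom hom ≫ H.comp

/-- The identities of an operad, as a morphism `1 ⟶ G` of `C`. -/
noncomputable def idsMap (G : TOperad T) : ⊤_ C ⟶ G.coll.left := G.ids.left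

/-- The composition of an operad, as a morphism `G ∘ G ⟶ G` of `C`. -/
noncomputable def compMap (G : TOperad T) : act G.coll.left G.coll ⟶ G.coll.left := G.comp.left

theorem idsMap_w (G : TOperad T) : G.idsMap ≫ G.coll.hom = T.η.app (⊤_ C) := Over.w G.ids

theorem compMap_w (G : TOperad T) : G.compMap ≫ G.coll.hom =
    actFst G.coll.left G.coll ≫ T.map G.coll.hom ≫ T.μ.app (⊤_ C) := Over.w G.comp

/-- The unit `A ⟶ A_G`. -/
noncomputable def unitMap (G : TOperad T) (A : C) : A ⟶ act A G.coll :=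
  actLift (T.η.app A) (terminal.from A ≫ G.idsMap) (by
    rw [Category.assoc, idsMap_w]
    exact (T.η.naturality (terminal.from A)).symm)

/-- The multiplication `(A_G)_G ⟶ A_G`. -/
noncomputable def multMap (G : TOperad T) (A : C) : act (act A G.coll) G.coll ⟶ act A G.coll :=
  actLift (actFst (act A G.coll) G.coll ≫ T.map (actFst A G.coll) ≫ T.μ.app A)
    (actProj A G.coll G.coll ≫ G.compMap) (by
      have e : (actProj A G.coll G.coll ≫ G.compMap) ≫ G.coll.hom =
          actProj A G.coll G.coll ≫ actFst G.coll.left G.coll ≫ T.map G.coll.hom ≫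
            T.μ.app (⊤_ C) := by
        rw [Category.assoc, compMap_w]
      rw [e, actProj, actMap, actLift_fst_assoc]
      simp only [Category.assoc]
      rw [← T.mu_naturality, ← T.map_comp_assoc, ← T.map_comp_assoc, act_condition])

@[simp]
theorem unitMap_fst (G : TOperad T) (A : C) : G.unitMap A ≫ actFst A G.coll = T.η.app A :=
  actLift_fst _ _ _

@[simp]
theorem unitMap_snd (G : TOperad T) (A : C) :
    G.unitMap A ≫ actSnd A G.coll = terminal.from A ≫ G.idsMap :=
  actLift_snd _ _ _

@[simp]
theorem multMap_fst (G : TOperad T) (A : C) : G.multMap A ≫ actFst A G.coll =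
    actFst (act A G.coll) G.coll ≫ T.map (actFst A G.coll) ≫ T.μ.app A :=
  actLift_fst _ _ _

@[simp]
theorem multMap_snd (G : TOperad T) (A : C) :
    G.multMap A ≫ actSnd A G.coll = actProj A G.coll G.coll ≫ G.compMap :=
  actLift_snd _ _ _

theorem unitMap_eq (G : TOperad T) (A : C) :
    G.unitMap A = actUnit A ≫ actMap (𝟙 A) G.ids := by
  apply act_hom_ext
  · rw [unitMap_fst, Category.assoc, actMap_fst, T.map_id, Category.comp_id, actUnit_fst]
  · rw [unitMap_snd, Category.assoc, actMap_snd, ← Category.assoc, actUnit_snd]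
    rfl

theorem multMap_eq (G : TOperad T) (A : C) :
    G.multMap A = actAssoc A G.coll G.coll ≫ actMap (𝟙 A) G.comp := by
  apply act_hom_ext
  · rw [multMap_fst, Category.assoc, actMap_fst, T.map_id, Category.comp_id, actAssoc_fst]
  · rw [multMap_snd, Category.assoc, actMap_snd, ← Category.assoc, actAssoc_snd]
    rfl

theorem ids_compMap (G : TOperad T) :
    actMap G.idsMap (𝟙 G.coll) ≫ G.compMap = actSnd (⊤_ C) G.coll :=
  congrArg (fun k => k.left) G.ids_comp

theorem compMap_ids (G : TOperad T) : G.unitMap G.coll.left ≫ G.compMap = 𝟙 G.coll.left := by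
  rw [unitMap_eq, Category.assoc]
  exact congrArg (fun k => k.left) G.comp_ids

theorem compMap_assoc (G : TOperad T) :
    actMap G.compMap (𝟙 G.coll) ≫ G.compMap = G.multMap G.coll.left ≫ G.compMap := by
  rw [multMap_eq, Category.assoc]
  exact congrArg (fun k => k.left) G.assoc

theorem unitMap_naturality (G : TOperad T) {A B : C} (a : A ⟶ B) :
    a ≫ G.unitMap B = G.unitMap A ≫ actMap a (𝟙 G.coll) := by
  apply act_hom_ext
  · rw [Category.assoc, unitMap_fst, Category.assoc, actMap_fst, ← Category.assoc, unitMap_fst]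
    exact T.η.naturality a
  · rw [Category.assoc, unitMap_snd, Category.assoc, actMap_snd, Over.id_left, Category.comp_id,
      unitMap_snd, ← Category.assoc, terminal.comp_from]

theorem multMap_naturality (G : TOperad T) {A B : C} (a : A ⟶ B) :
    actMap (actMap a (𝟙 G.coll)) (𝟙 G.coll) ≫ G.multMap B =
      G.multMap A ≫ actMap a (𝟙 G.coll) := by
  apply act_hom_ext
  · rw [Category.assoc, multMap_fst, Category.assoc, actMap_fst, ← Category.assoc, actMap_fst,
      ← Category.assoc (G.multMap A), multMap_fst]
    simp only [Category.assoc]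
    rw [← T.map_comp_assoc, actMap_fst, T.map_comp_assoc, T.mu_naturality]
  · rw [Category.assoc, multMap_snd, Category.assoc, actMap_snd, Over.id_left, Category.comp_id,
      multMap_snd, ← Category.assoc, actProj, actMap_comp, actMap_snd, Over.id_left,
      Category.comp_id, Category.comp_id]
    rfl

/-- The monad `(-)_G` induced by an operad `G`. -/
noncomputable def monad (G : TOperad T) : Monad C where
  toFunctor :=
    { obj := fun A => act A G.coll
      map := fun a => actMap a (𝟙 G.coll)
      map_id := fun A => actMap_id A G.coll
      map_comp := fun a b => by rw [actMap_comp, Category.comp_id] }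
  η :=
    { app := fun A => G.unitMap A
      naturality := fun _ _ a => G.unitMap_naturality a }
  μ :=
    { app := fun A => G.multMap A
      naturality := fun _ _ a => G.multMap_naturality a }
  assoc A := by
    change actMap (G.multMap A) (𝟙 G.coll) ≫ G.multMap A =
      G.multMap (act A G.coll) ≫ G.multMap A
    apply act_hom_ext
    · rw [Category.assoc, multMap_fst, Category.assoc, multMap_fst, ← Category.assoc, actMap_fst,
        ← Category.assoc (G.multMap _), multMap_fst]
      simp only [Category.assoc]
      rw [← T.map_comp_assoc, multMap_fst]
      simp only [Functor.map_comp, Category.assoc]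
      rw [T.assoc, T.mu_naturality_assoc]
    · rw [Category.assoc, multMap_snd, Category.assoc, multMap_snd, ← Category.assoc, actProj,
        actMap_comp, multMap_snd, ← actMap_comp, Category.assoc, compMap_assoc,
        ← Category.assoc, ← Category.assoc, actProj, multMap_naturality]
  left_unit A := by
    change G.unitMap (act A G.coll) ≫ G.multMap A = 𝟙 (act A G.coll)
    apply act_hom_ext
    · rw [Category.assoc, multMap_fst, ← Category.assoc, unitMap_fst, Category.id_comp,
        ← T.unit_naturality_assoc, T.left_unit]
      exact Category.comp_id _
    · rw [Category.assoc, multMap_snd, actProj, ← Category.assoc, ← unitMap_naturality,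
        Category.assoc, compMap_ids, Category.comp_id, Category.id_comp]
  right_unit A := by
    change actMap (G.unitMap A) (𝟙 G.coll) ≫ G.multMap A = 𝟙 (act A G.coll)
    apply act_hom_ext
    · rw [Category.assoc, multMap_fst, ← Category.assoc, actMap_fst, Category.id_comp,
        Category.assoc, ← T.map_comp_assoc, unitMap_fst, T.right_unit]
      exact Category.comp_id _
    · rw [Category.assoc, multMap_snd, actProj, ← Category.assoc, actMap_comp, unitMap_snd,
        ← actMap_comp, Category.assoc, ids_compMap, actMap_snd, Over.id_left, Category.comp_id,
        Category.id_comp]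

/-- The category of algebras for an operad `G`: algebras for the monad `(-)_G`. -/
abbrev Alg (G : TOperad T) : Type (max u v) := G.monad.Algebra

variable {G H : TOperad T}

/-- The morphism `A_f : A_G ⟶ A_H`: the identity on `T A`, and `f` on operations. -/
noncomputable def Hom.actHom (f : Hom G H) (A : C) : act A G.coll ⟶ act A H.coll :=
  actLift (actFst A G.coll) (actSnd A G.coll ≫ f.hom.left) (by
    rw [Category.assoc, Over.w, act_condition])

theorem Hom.actHom_eq (f : Hom G H) (A : C) : f.actHom A = actMap (𝟙 A) f.hom := by
  apply act_hom_ext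
  · rw [actHom, actLift_fst, actMap_fst, T.map_id, Category.comp_id]
  · rw [actHom, actLift_snd, actMap_snd]

theorem Hom.idsMap_hom (f : Hom G H) : G.idsMap ≫ f.hom.left = H.idsMap :=
  congrArg (fun k => k.left) f.ids_hom

theorem Hom.compMap_hom (f : Hom G H) :
    G.compMap ≫ f.hom.left = actMap f.hom.left f.hom ≫ H.compMap :=
  congrArg (fun k => k.left) f.comp_hom

/-- The morphisms `A_f` form a morphism of monads. -/
noncomputable def Hom.monadHom (f : Hom G H) : G.monad ⟶ H.monad where
  app A := f.actHom A
  naturality A B a := by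
    change actMap a (𝟙 G.coll) ≫ f.actHom B = f.actHom A ≫ actMap a (𝟙 H.coll)
    rw [actHom_eq, actHom_eq, actMap_comp, actMap_comp, Category.comp_id, Category.comp_id,
      Category.id_comp, Category.id_comp]
  app_η A := by
    change G.unitMap A ≫ f.actHom A = H.unitMap A
    apply act_hom_ext
    · rw [Category.assoc, actHom, actLift_fst, unitMap_fst, unitMap_fst]
    · rw [Category.assoc, actHom, actLift_snd, unitMap_snd, ← Category.assoc, unitMap_snd,
        Category.assoc, idsMap_hom]
  app_μ A := by
    change G.multMap A ≫ f.actHom A =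
      (actMap (f.actHom A) (𝟙 G.coll) ≫ f.actHom (act A H.coll)) ≫ H.multMap A
    rw [actHom_eq f (act A H.coll), actMap_comp, Category.comp_id, Category.id_comp]
    apply act_hom_ext
    · rw [Category.assoc, Category.assoc, multMap_fst, ← Category.assoc (actMap _ _), actMap_fst]
      rw [actHom, actLift_fst, multMap_fst, Category.assoc, ← T.map_comp_assoc, actLift_fst]
    · rw [Category.assoc, Category.assoc, multMap_snd, ← Category.assoc (actMap _ _), actProj,
        actMap_comp, Category.comp_id]
      rw [actHom, actLift_snd, ← Category.assoc, multMap_snd, Category.assoc,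
        compMap_hom, ← Category.assoc, actProj, actMap_comp, Category.id_comp]

/-- The functor `H-Alg ⥤ G-Alg` induced by a morphism `f : G ⟶ H` of operads, sending an algebra
`(A, θ)` to `(A, A_f ≫ θ)` and acting as the identity on underlying morphisms. -/
noncomputable def Hom.algFunctor (f : Hom G H) : H.Alg ⥤ G.Alg :=
  Monad.algebraFunctorOfMonadHom f.monadHom

end

end TOperad

/-! ### Globular operads -/

/-- A globular operad: an operad over the free strict `ω`-category monad on globular sets. -/
abbrev GlobularOperad : Type (u + 1) := TOperad FreeOmega.monad.{u}

namespace GlobularOperad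

/-- A morphism of globular operads. -/
abbrev Hom (G H : GlobularOperad.{u}) : Type u := TOperad.Hom G H

/-- The underlying globular set of a globular operad. -/
noncomputable abbrev gset (G : GlobularOperad.{u}) : GlobularSet.{u} := G.coll.left

/-- The underlying morphism of globular sets of a morphism of globular operads. -/
noncomputable abbrev Hom.gmap {G H : GlobularOperad.{u}} (f : Hom G H) : G.gset ⟶ H.gset :=
  f.hom.left

end GlobularOperad

/-! ### Operad morphisms with a section, over an arbitrary monad `T`. -/

namespace TOperad

/-! Both claims amount to cancelling the comparison maps `A_f : A_G ⟶ A_H` on the left. The functor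
`f^*` keeps the carrier of an algebra and replaces its structure map `θ` by `A_f ≫ θ`. If `A_f` is
an epimorphism, `θ` is recovered from `A_f ≫ θ`, so an `H`-algebra is determined by its image: this
is injectivity on objects. Likewise, for `H`-algebras `X` and `Y` and a morphism `g` of the
carriers, the square saying that `g` is a morphism of `G`-algebras is, by naturality of `A_f` in
`A`, the square saying that `g` is a morphism of `H`-algebras, precomposed with `A_f` at the carrier
of `X`. Cancelling gives fullness.

It remains to see that every `A_f` is epi (`Hom.isSplitEpi_actHom`). The object `A_G` is functorial
in the collection `G` alone, without reference to the operad structure. A section of `f` respects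
the maps to `T 1` automatically, so it induces a section of every `A_f`. That this section need not
respect `ids` and `comp` does no harm: it serves only to cancel `A_f`, and no monad morphism in the
reverse direction is ever needed.

Nothing here is special to globular sets: the three lemmas hold for any monad `T` on a category with
pullbacks and a terminal object, and the unit and associativity laws of algebras play no part in the
cancellation. -/

/-- If the underlying morphism of `f` is a split epimorphism, then so is each `A_f`: a section of
`f` is automatically a morphism of collections. -/
theorem Hom.isSplitEpi_actHom {C : Type u} [Category.{v} C] [HasTerminal C] [HasPullbacks C]
    {T : Monad C} {G H : TOperad T} (f : Hom G H) [IsSplitEpi f.hom.left] (A : C) :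
    IsSplitEpi (f.actHom A) := by
  -- With `g`, `h` the structure maps of `G`, `H` and `f'` the chosen section, `g = f ≫ h` because
  -- `f` lies over `T 1`; hence `f' ≫ g = f' ≫ f ≫ h = h`, and `f'` lies over `T 1` as well.
  let k : H.coll ⟶ G.coll := Over.homMk (section_ f.hom.left) (by
    rw [← Over.w f.hom, IsSplitEpi.id_assoc])
  have hk : k ≫ f.hom = 𝟙 H.coll := by
    ext
    exact IsSplitEpi.id f.hom.left
  -- The section of `A_f` is the identity on the `T A` component and `k` on operations. Since `A_f`
  -- is itself `actMap (𝟙 A) f.hom`, bifunctoriality of `actMap` reduces the claim to `hk`.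
  refine IsSplitEpi.mk' ⟨actMap (𝟙 A) k, ?_⟩
  rw [Hom.actHom_eq, actMap_comp, hk, Category.comp_id, actMap_id]

/-- The functor induced by `f` is injective on objects if each `A_f` is an epimorphism. -/
theorem Hom.algFunctor_obj_injective {C : Type u} [Category.{v} C] [HasTerminal C]
    [HasPullbacks C] {T : Monad C} {G H : TOperad T} (f : Hom G H)
    [∀ A, Epi (f.actHom A)] : Function.Injective f.algFunctor.obj := by
  -- The discarded fields are the algebra laws; being propositions, they cannot distinguish two
  -- algebras with the same carrier and structure map.
  rintro ⟨A, a, _, _⟩ ⟨B, b, _, _⟩ h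
  -- The two structure maps have types depending on the carriers, so `ha` is a heterogeneous
  -- equality between `A_f ≫ a` and `B_f ≫ b`. It becomes an ordinary one only after the carriers
  -- have been identified.
  injection h with hA ha
  subst hA
  obtain rfl : a = b := (cancel_epi (f.actHom A)).1 (eq_of_heq ha)
  rfl

/-- The functor induced by `f` is full if each `A_f` is an epimorphism. -/
theorem Hom.algFunctor_full {C : Type u} [Category.{v} C] [HasTerminal C]
    [HasPullbacks C] {T : Monad C} {G H : TOperad T} (f : Hom G H)
    [∀ A, Epi (f.actHom A)] : f.algFunctor.Full where
  map_surjective {X Y} k := by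
    let g : X.A ⟶ Y.A := k.f
    -- The `G`-algebra square of `k`, with the structure maps of the image algebras unfolded to `A_f
    -- ≫ θ`.
    have hk : G.monad.map g ≫ f.monadHom.app Y.A ≫ Y.a =
      (f.monadHom.app X.A ≫ X.a) ≫ g := k.h
    -- Naturality of the comparison map moves it to the front of the left side as well, so that both
    -- sides begin with the same epimorphism.
    have hg : f.monadHom.app X.A ≫ H.monad.map g ≫ Y.a = f.monadHom.app X.A ≫ X.a ≫ g := by
      rw [← f.monadHom.naturality_assoc g, hk, Category.assoc]
    -- Since `f^*` is the identity on underlying morphisms, the only candidate for a preimage is `g`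
    -- itself, and its image is `k` by definition.
    exact ⟨⟨g, (cancel_epi (f.actHom X.A)).1 hg⟩, rfl⟩

end TOperad

/-- The general lemmas applied to the free strict `ω`-category monad. -/
theorem mainTheorem5 {G H : GlobularOperad.{u}} (f : GlobularOperad.Hom G H)
    (hf : IsSplitEpi f.gmap) :
    Function.Injective f.algFunctor.obj ∧ f.algFunctor.Full := by
  have : IsSplitEpi f.hom.left := hf
  -- As a local instance this supplies the hypothesis `∀ A, Epi (f.actHom A)` of both lemmas, a
  -- split epimorphism being an epimorphism.
  have (A : GlobularSet.{u}) : IsSplitEpi (f.actHom A) := f.isSplitEpi_actHom A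
  exact ⟨f.algFunctor_obj_injective, f.algFunctor_full⟩
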